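/- For $u\in L^2(\mathbb R)$ (complex-valued) let $\hat u(\xi)=\frac1{\sqrt{2\pi}}\int_{\mathbb R}e^{-ix\xi}u(x)\,dx$ denote the Fourier transform (extended to $L^2$ by Plancherel), and for $u$ with $\hat u$ compactly supported let $$e^{it\Delta}u(x)=\frac1{\sqrt{2\pi}}\int_{\mathbb R}e^{ix\xi-it\xi^2}\,\hat u(\xi)\,d\xi ,\qquad x,t\in\mathbb R,$$ be the free Schrödinger solution. Write $\|F\|_{L^\gamma_xL^\infty_t}=\big\|\,\|F(x,t)\|_{L^\infty_t(\mathbb R)}\big\|_{L^\gamma_x(\mathbb R)}$, and let $\chi_{[-1,1]}$ be the indicator function of $[-1,1]$. 1. Let $\gamma=2$ or $\gamma=3$. There is a constant $C=C(\gamma)>0$ such that $$\|\chi_{[-1,1]}(t)\,e^{it\Delta}u(x)\|_{L^\gamma_xL^\infty_t}\le C\,N^{1/\gamma}\,\|u\|_{L^2}$$ whenever $N=2^k$ with $k\in\{0,1,2,\dots\}$ and $u\in L^2(\mathbb R)$ satisfies $\operatorname{supp}\hat u\subseteq\{\xi: N\le|\xi|\le 4N\}$, and also whenever $N=1$ and $u\in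 L^2(\mathbb R)$ satisfies $\operatorname{supp}\hat u\subseteq\{\xi:|\xi|\le 1\}$. 2. Let $\gamma\ge4$ be a real number. There is a constant $C=C(\gamma)>0$ such that $$\|e^{it\Delta}u(x)\|_{L^\gamma_xL^\infty_t}\le C\,N^{\frac{\gamma-2}{2\gamma}}\,\|u\|_{L^2}$$ whenever $N=2^k$ with $k\in\mathbb Z$ and $u\in L^2(\mathbb R)$ satisfies $\operatorname{supp}\hat u\subseteq\{\xi: N\le|\xi|\le 4N\}$. -/

import Mathlib

open MeasureTheory Set
open scoped FourierTransform ENNReal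

namespace Schrodinger

/-- The (complex-valued) Lebesgue space `L²(ℝ)`. -/
abbrev L2 : Type := Lp ℂ 2 (volume : Measure ℝ)

/-- The Fourier transform of `u ∈ L²(ℝ)` in the normalization
`û(ξ) = (2π)^{-1/2} ∫ e^{-ixξ} u(x) dx`. Mathlib's transform `𝓕`, extended to `L²` by Plancherel,
is `(𝓕 u)(η) = ∫ e^{-2πixη} u(x) dx`, so `û(ξ) = (2π)^{-1/2} (𝓕 u)(ξ / 2π)`
(for almost every `ξ`). -/
noncomputable def hat (u : L2) (ξ : ℝ) : ℂ :=
  ((1 / Real.sqrt (2 * Real.pi) : ℝ) : ℂ) * (𝓕 u : L2) (ξ / (2 * Real.pi))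

/-- The frequency support of `u` lies in the closed set `S`: `û` vanishes almost everywhere
off `S`. -/
def FreqSupportedIn (u : L2) (S : Set ℝ) : Prop :=
  ∀ᵐ ξ : ℝ, ξ ∉ S → hat u ξ = 0

/-- The free Schrödinger propagator
`(e^{itΔ} u)(x) = (2π)^{-1/2} ∫ e^{ixξ - itξ²} û(ξ) dξ`. The integral converges absolutely for
every `x` and `t` when `û` has compact support, since then `û ∈ L² ∩ L¹`. -/
noncomputable def propagator (u : L2) (x t : ℝ) : ℂ :=
  ((1 / Real.sqrt (2 * Real.pi) : ℝ) : ℂ) *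
    ∫ ξ : ℝ, Complex.exp (Complex.I * ((x * ξ - t * ξ ^ 2 : ℝ) : ℂ)) * hat u ξ

/-- The mixed norm `‖F‖_{L^p_x L^q_t}` over `ℝ × ℝ`, with values in `[0, ∞]`. -/
noncomputable def mixedNorm (p q : ℝ≥0∞) (F : ℝ → ℝ → ℂ) : ℝ≥0∞ :=
  eLpNorm (fun x : ℝ => eLpNorm (fun t : ℝ => F x t) q volume) p volume

end Schrodinger

namespace Schrodinger

/-! The supremum over times is linearized: it suffices to bound x ↦ F(x, t(x)), with F the wave
integral, uniformly over all measurable choices t(x). By duality this is a `T T*` estimate, whose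
kernel is the dispersive kernel of the frequency weight evaluated at (x - y, t(x) - t(y)), so it
must be bounded without using anything about the times beyond their range.

Instead of a smooth cutoff the weight is the Gaussian exp(-ξ²/N²), comparable to 1 on |ξ| ≤ 4N. Its
kernel K is explicit, and no stationary phase is needed: |K(x, t)| ≲ N^{1/2} |x|^{-1/2} for all t,
and |K(x, t)| ≲ N² |x|^{-2} for |t| ≤ 2 and N ≥ 1.

The first bound and `hardy_littlewood_sobolev_half` give the global L⁴ estimate
(`BandLimited.lintegral_pow_four_le`). The two bounds meet at |x| = N and together yield a majorant
of integral O(N), so Schur's test gives the local L² estimate (`BandLimited.lintegral_sq_le`). The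
case γ = 3 follows from these by Cauchy–Schwarz. For γ > 4 the L⁴ estimate is combined with the
trivial bound |F| ≲ N^{1/2} ‖u‖. -/

/-- The plane wave `e^{i(xξ - tξ²)}` solving the free Schrödinger equation. -/
noncomputable def phase (x t ξ : ℝ) : ℂ :=
  Complex.exp (Complex.I * ((x * ξ - t * ξ ^ 2 : ℝ) : ℂ))

/-- The unnormalized propagator of a function `g` given on the frequency side. -/
noncomputable def waveIntegral (g : ℝ → ℂ) (x t : ℝ) : ℂ := ∫ ξ : ℝ, phase x t ξ * g ξ

lemma norm_phase (x t ξ : ℝ) : ‖phase x t ξ‖ = 1 := by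
  rw [phase, mul_comm]; exact Complex.norm_exp_ofReal_mul_I _

lemma phase_mul_conj (x y t s ξ : ℝ) :
    phase x t ξ * (starRingEnd ℂ) (phase y s ξ) = phase (x - y) (t - s) ξ := by
  simp only [phase, ← Complex.exp_conj, map_mul, Complex.conj_I, Complex.conj_ofReal,
    ← Complex.exp_add]
  congr 1
  push_cast
  ring

@[fun_prop]
lemma continuous_phase : Continuous fun p : ℝ × ℝ × ℝ => phase p.1 p.2.1 p.2.2 := by
  unfold phase; fun_prop

/-! ### The dispersive kernel of a Gaussian weight -/

/-- The integrand is a Gaussian with complex parameter a + it, so its Fourier integral is known in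
closed form. -/
lemma norm_gaussian_kernel {a : ℝ} (ha : 0 < a) (x t : ℝ) :
    ‖∫ ξ : ℝ, phase x t ξ * (Real.exp (-a * ξ ^ 2) : ℂ)‖ =
      (Real.pi / Real.sqrt (a ^ 2 + t ^ 2)) ^ (1 / 2 : ℝ) *
        Real.exp (-(a * x ^ 2 / (4 * (a ^ 2 + t ^ 2)))) := by
  set b : ℂ := a + t * Complex.I with hb
  have hbre : 0 < b.re := by simpa [hb] using ha
  have h1 := fourierIntegral_gaussian hbre (x : ℂ)
  have h2 : ∀ ξ : ℝ, phase x t ξ * (Real.exp (-a * ξ ^ 2) : ℂ) =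
      Complex.exp (Complex.I * x * ξ) * Complex.exp (-b * ξ ^ 2) := fun ξ => by
    rw [phase, Complex.ofReal_exp, ← Complex.exp_add, ← Complex.exp_add, hb]
    congr 1
    push_cast
    ring
  have hn : ‖b‖ = Real.sqrt (a ^ 2 + t ^ 2) := by
    rw [Complex.norm_def, Complex.normSq_apply]
    simp [hb, sq]
  simp_rw [h2]
  rw [h1, norm_mul, Complex.norm_exp]
  have h3 : ((1 : ℂ) / 2) = ((1 / 2 : ℝ) : ℂ) := by push_cast; rfl
  rw [h3, Complex.norm_cpow_real, norm_div, hn, Complex.norm_real,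
    Real.norm_of_nonneg Real.pi_pos.le]
  congr 2
  have h4 : (-(x : ℂ) ^ 2 / (4 * b)) = ((-(x ^ 2) / 4 : ℝ) : ℂ) * b⁻¹ := by
    push_cast; field_simp
  rw [h4, Complex.re_ofReal_mul, Complex.inv_re, Complex.normSq_apply]
  simp only [hb, Complex.add_re, Complex.ofReal_re, Complex.mul_re, Complex.I_re, mul_zero,
    Complex.ofReal_im, Complex.I_im, sub_self, add_zero, Complex.add_im, Complex.mul_im,
    mul_one, zero_add]
  field_simp

lemma rpow_mul_exp_neg_le_one {θ y : ℝ} (hθ : 0 ≤ θ) (hθ1 : θ ≤ 1) (hy : 0 ≤ y) :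
    y ^ θ * Real.exp (-y) ≤ 1 := by
  rw [Real.exp_neg, ← div_eq_mul_inv, div_le_one (Real.exp_pos _)]
  rcases le_total y 1 with h | h
  · exact (Real.rpow_le_one hy h hθ).trans (Real.one_le_exp hy)
  · calc y ^ θ ≤ y ^ (1 : ℝ) := Real.rpow_le_rpow_of_exponent_le h hθ1
      _ = y := Real.rpow_one y
      _ ≤ Real.exp y := by linarith [Real.add_one_le_exp y]

lemma sqrt_pi_le_two : Real.pi ^ (1 / 2 : ℝ) ≤ 2 := by
  rw [← Real.sqrt_eq_rpow]
  exact Real.sqrt_le_iff.2 ⟨by norm_num, by linarith [Real.pi_le_four]⟩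

/-- The Gaussian factor is traded for a power through exp(-y) ≤ y^{-θ}. The exponent θ is free: θ =
1/4 cancels all dependence on t, and θ = 1 buys integrable decay in x at the price of a bound on t.
-/
lemma gaussian_kernel_le {a : ℝ} (ha : 0 < a) {x : ℝ} (hx : x ≠ 0) (t : ℝ) {θ : ℝ} (hθ : 0 ≤ θ)
    (hθ1 : θ ≤ 1) :
    ‖∫ ξ : ℝ, phase x t ξ * (Real.exp (-a * ξ ^ 2) : ℂ)‖ ≤
      2 * (a ^ 2 + t ^ 2) ^ (θ - 1 / 4) * (4 / (a * x ^ 2)) ^ θ := by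
  rw [norm_gaussian_kernel ha]
  set s := a ^ 2 + t ^ 2 with hs
  have hs0 : 0 < s := by positivity
  have hx2 : 0 < x ^ 2 := by positivity
  have h1 := rpow_mul_exp_neg_le_one hθ hθ1 (y := a * x ^ 2 / (4 * s)) (by positivity)
  have h2 : Real.exp (-(a * x ^ 2 / (4 * s))) ≤ (4 * s / (a * x ^ 2)) ^ θ := by
    rw [← inv_div (a * x ^ 2), Real.inv_rpow (by positivity)]
    rw [le_inv_comm₀ (Real.exp_pos _) (by positivity), ← one_div, le_div_iff₀ (Real.exp_pos _)]
    exact h1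
  have h3 : (Real.pi / Real.sqrt s) ^ (1 / 2 : ℝ) ≤ 2 * s ^ (-(1 / 4) : ℝ) := by
    rw [Real.div_rpow Real.pi_pos.le (by positivity), Real.sqrt_eq_rpow s, ← Real.rpow_mul hs0.le,
      div_eq_mul_inv, ← Real.rpow_neg hs0.le]
    norm_num
    gcongr
    simpa using sqrt_pi_le_two
  calc _ ≤ (2 * s ^ (-(1 / 4) : ℝ)) * (4 * s / (a * x ^ 2)) ^ θ := by gcongr
    _ = _ := by
      rw [show 4 * s / (a * x ^ 2) = s * (4 / (a * x ^ 2)) by ring,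
        Real.mul_rpow hs0.le (by positivity), sub_eq_add_neg, Real.rpow_add hs0]
      ring

lemma gaussian_kernel_enorm_le {N : ℝ} (hN : 0 < N) (x t : ℝ) :
    ‖∫ ξ : ℝ, phase x t ξ * (Real.exp (-(1 / N ^ 2) * ξ ^ 2) : ℂ)‖ₑ ≤
      ENNReal.ofReal (4 * N ^ (1 / 2 : ℝ)) * ‖x‖ₑ ^ (-(1 / 2) : ℝ) := by
  -- At x = 0 the right side is infinite, since a negative power of 0 is ∞ in `ℝ≥0∞`.
  rcases eq_or_ne x 0 with rfl | hx
  · rw [enorm_zero, ENNReal.zero_rpow_of_neg (by norm_num), ENNReal.mul_top]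
    · exact le_top
    · simp; positivity
  have hx' : 0 < |x| := abs_pos.2 hx
  have h := gaussian_kernel_le (a := 1 / N ^ 2) (by positivity) hx t (θ := 1 / 4)
    (by norm_num) (by norm_num)
  rw [sub_self, Real.rpow_zero, mul_one] at h
  rw [← ofReal_norm, Real.enorm_eq_ofReal_abs, ENNReal.ofReal_rpow_of_pos hx',
    ← ENNReal.ofReal_mul (by positivity)]
  refine ENNReal.ofReal_le_ofReal (h.trans ?_)
  have h5 : (4 / (1 / N ^ 2 * x ^ 2)) = (2 * N * |x|⁻¹) ^ (2 : ℝ) := by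
    rw [Real.rpow_two, mul_pow, inv_pow, sq_abs]; field_simp; norm_num
  rw [h5, ← Real.rpow_mul (by positivity), Real.mul_rpow (by positivity) (by positivity),
    Real.mul_rpow (by positivity) (by positivity), Real.inv_rpow hx'.le, Real.rpow_neg hx'.le]
  norm_num
  have h6 : (2 : ℝ) ^ (1 / 2 : ℝ) ≤ 2 := by
    rw [← Real.sqrt_eq_rpow]
    exact Real.sqrt_le_iff.2 ⟨by norm_num, by norm_num⟩
  have h7 : 0 ≤ N ^ (1 / 2 : ℝ) * (|x| ^ (1 / 2 : ℝ))⁻¹ := by positivity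
  nlinarith

lemma gaussian_kernel_enorm_le_of_far {N : ℝ} (hN : 1 ≤ N) (x : ℝ) {t : ℝ} (ht : |t| ≤ 2) :
    ‖∫ ξ : ℝ, phase x t ξ * (Real.exp (-(1 / N ^ 2) * ξ ^ 2) : ℂ)‖ₑ ≤
      ENNReal.ofReal (40 * N ^ 2) * ‖x‖ₑ ^ (-2 : ℝ) := by
  have hN0 : 0 < N := by linarith
  rcases eq_or_ne x 0 with rfl | hx
  · rw [enorm_zero, ENNReal.zero_rpow_of_neg (by norm_num), ENNReal.mul_top]
    · exact le_top
    · simp; positivity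
  have hx' : 0 < |x| := abs_pos.2 hx
  have h := gaussian_kernel_le (a := 1 / N ^ 2) (by positivity) hx t (θ := 1)
    (by norm_num) (by norm_num)
  rw [← ofReal_norm, Real.enorm_eq_ofReal_abs, ENNReal.ofReal_rpow_of_pos hx',
    ← ENNReal.ofReal_mul (by positivity)]
  refine ENNReal.ofReal_le_ofReal (h.trans ?_)
  rw [Real.rpow_one, Real.rpow_neg hx'.le, Real.rpow_two, sq_abs]
  have h5 : (4 / (1 / N ^ 2 * x ^ 2)) = 4 * N ^ 2 * (x ^ 2)⁻¹ := by field_simp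
  have ha : (1 / N ^ 2) ^ 2 ≤ 1 := by
    have : 1 / N ^ 2 ≤ 1 := by
      rw [div_le_one (by positivity)]; nlinarith
    exact pow_le_one₀ (by positivity) this
  have ht2 : t ^ 2 ≤ 4 := by
    rw [← sq_abs]; nlinarith [abs_nonneg t]
  -- This is where N ≥ 1 and |t| ≤ 2 enter: a² + t² ≤ 1 + 4. The constant 40 is 2 · 5 · 4.
  have h6 : ((1 / N ^ 2) ^ 2 + t ^ 2) ^ ((1 : ℝ) - 1 / 4) ≤ 5 := by
    calc ((1 / N ^ 2) ^ 2 + t ^ 2) ^ ((1 : ℝ) - 1 / 4) ≤ 5 ^ ((1 : ℝ) - 1 / 4) := by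
          apply Real.rpow_le_rpow (by positivity) (by linarith) (by norm_num)
      _ ≤ 5 ^ (1 : ℝ) := Real.rpow_le_rpow_of_exponent_le (by norm_num) (by norm_num)
      _ = 5 := Real.rpow_one _
  rw [h5]
  have h7 : 0 ≤ N ^ 2 * (x ^ 2)⁻¹ := by positivity
  nlinarith

/-! ### Integral inequalities: Hardy–Littlewood–Sobolev, Schur, Cauchy–Schwarz -/

lemma lintegral_comp_abs {f : ℝ → ℝ≥0∞} (hf : Measurable f) :
    ∫⁻ z : ℝ, f |z| = 2 * ∫⁻ z in Ioi (0 : ℝ), f z := by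
  have h1 : ∫⁻ z in Ioi (0 : ℝ), f |z| = ∫⁻ z in Ioi (0 : ℝ), f z :=
    setLIntegral_congr_fun measurableSet_Ioi fun z hz => by rw [abs_of_pos hz]
  have h2 : ∫⁻ z in Iio (0 : ℝ), f |z| = ∫⁻ z in Ioi (0 : ℝ), f |z| := by
    have := (Measure.measurePreserving_neg (volume : Measure ℝ)).setLIntegral_comp_preimage
      (s := Ioi 0) measurableSet_Ioi (f := fun z => f |z|) (by fun_prop)
    simpa using this
  rw [← lintegral_add_compl _ (measurableSet_Ioi (a := (0 : ℝ))), compl_Ioi,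
    setLIntegral_congr Iio_ae_eq_Iic.symm, h2, h1, two_mul]

lemma lintegral_rpow_neg_half_near {r : ℝ} (hr : 0 < r) :
    ∫⁻ z : ℝ, {z : ℝ | |z| ≤ r}.indicator (fun z => ‖z‖ₑ ^ (-(1 / 2) : ℝ)) z =
      ENNReal.ofReal (4 * r ^ (1 / 2 : ℝ)) := by
  have h := lintegral_comp_abs
    (f := (Iic r).indicator fun z : ℝ => ENNReal.ofReal z ^ (-(1 / 2) : ℝ))
    (Measurable.indicator (by fun_prop) measurableSet_Iic)
  have h0 : (fun z : ℝ => {z : ℝ | |z| ≤ r}.indicator (fun z => ‖z‖ₑ ^ (-(1 / 2) : ℝ)) z) =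
      fun z => (Iic r).indicator (fun z : ℝ => ENNReal.ofReal z ^ (-(1 / 2) : ℝ)) |z| := by
    ext z
    simp [indicator, Real.enorm_eq_ofReal_abs]
  have hi := intervalIntegral.intervalIntegrable_rpow' (a := 0) (b := r) (r := -(1 / 2))
    (by norm_num)
  rw [intervalIntegrable_iff_integrableOn_Ioc_of_le hr.le] at hi
  rw [h0, h, lintegral_indicator measurableSet_Iic, Measure.restrict_restrict measurableSet_Iic,
    Iic_inter_Ioi]
  have h1 : ∫⁻ z in Ioc 0 r, ENNReal.ofReal z ^ (-(1 / 2) : ℝ) =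
      ∫⁻ z in Ioc 0 r, ENNReal.ofReal (z ^ (-(1 / 2) : ℝ)) :=
    setLIntegral_congr_fun measurableSet_Ioc fun z hz => ENNReal.ofReal_rpow_of_pos hz.1
  rw [h1, ← ofReal_integral_eq_lintegral_ofReal hi, ← intervalIntegral.integral_of_le hr.le,
    integral_rpow (Or.inl (by norm_num)), ← ENNReal.ofReal_ofNat 2,
    ← ENNReal.ofReal_mul (by norm_num)]
  · congr 1
    norm_num
    ring
  · filter_upwards [ae_restrict_mem measurableSet_Ioc] with z hz
    exact Real.rpow_nonneg hz.1.le _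

lemma lintegral_rpow_neg_two_far {r : ℝ} (hr : 0 < r) :
    ∫⁻ z : ℝ, {z : ℝ | |z| ≤ r}ᶜ.indicator (fun z => ‖z‖ₑ ^ (-2 : ℝ)) z =
      ENNReal.ofReal (2 / r) := by
  have h := lintegral_comp_abs
    (f := (Ioi r).indicator fun z : ℝ => ENNReal.ofReal z ^ (-2 : ℝ))
    (Measurable.indicator (by fun_prop) measurableSet_Ioi)
  have h0 : (fun z : ℝ => {z : ℝ | |z| ≤ r}ᶜ.indicator (fun z => ‖z‖ₑ ^ (-2 : ℝ)) z) =
      fun z => (Ioi r).indicator (fun z : ℝ => ENNReal.ofReal z ^ (-2 : ℝ)) |z| := by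
    ext z
    simp [indicator, Real.enorm_eq_ofReal_abs]
  rw [h0, h, lintegral_indicator measurableSet_Ioi, Measure.restrict_restrict measurableSet_Ioi,
    Ioi_inter_Ioi, sup_of_le_left hr.le]
  have h1 : ∫⁻ z in Ioi r, ENNReal.ofReal z ^ (-2 : ℝ) =
      ∫⁻ z in Ioi r, ENNReal.ofReal (z ^ (-2 : ℝ)) :=
    setLIntegral_congr_fun measurableSet_Ioi fun z hz =>
      ENNReal.ofReal_rpow_of_pos (hr.trans hz)
  rw [h1, ← ofReal_integral_eq_lintegral_ofReal
    (integrableOn_Ioi_rpow_of_lt (by norm_num) hr), integral_Ioi_rpow_of_lt (by norm_num) hr,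
    ← ENNReal.ofReal_ofNat 2, ← ENNReal.ofReal_mul (by norm_num)]
  · congr 1
    norm_num [Real.rpow_neg hr.le]
    rfl
  · filter_upwards [ae_restrict_mem measurableSet_Ioi] with z hz
    exact Real.rpow_nonneg (hr.trans hz).le _

/-- The fractional integral of order `1/2` of the part of `f` lying below the height `f x`. -/
lemma fractional_integral_below_le {f : ℝ → ℝ≥0∞} (hf : Measurable f) (x : ℝ) (hfx : f x ≠ ∞)
    (hA : ∫⁻ y, f y ^ (4 / 3 : ℝ) ≠ ∞) :
    ∫⁻ y, {y | f y ≤ f x}.indicator (fun y => f y * ‖x - y‖ₑ ^ (-(1 / 2) : ℝ)) y ≤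
      6 * f x ^ (1 / 3 : ℝ) * (∫⁻ y, f y ^ (4 / 3 : ℝ)) ^ (1 / 2 : ℝ) := by
  rcases eq_or_ne (f x) 0 with hx0 | hx0
  · have : ∀ y, {y | f y ≤ f x}.indicator (fun y => f y * ‖x - y‖ₑ ^ (-(1 / 2) : ℝ)) y = 0 := by
      intro y
      simp +contextual [indicator, hx0]
    simp_rw [this, lintegral_zero]
    exact zero_le
  rcases eq_or_ne (∫⁻ y, f y ^ (4 / 3 : ℝ)) 0 with hA0 | hA0
  · rw [lintegral_eq_zero_iff (by fun_prop)] at hA0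
    refine le_of_eq_of_le ?_ zero_le
    rw [lintegral_eq_zero_iff]
    · filter_upwards [hA0] with y hy
      have : f y = 0 := by
        simpa [ENNReal.rpow_eq_zero_iff, show ¬ (4 / 3 : ℝ) < 0 by norm_num] using hy
      simp [indicator, this]
    · exact Measurable.indicator (by fun_prop) (measurableSet_le hf measurable_const)
  obtain ⟨c, hc, hfc⟩ : ∃ c : ℝ, 0 < c ∧ f x = ENNReal.ofReal c :=
    ⟨(f x).toReal, ENNReal.toReal_pos hx0 hfx, (ENNReal.ofReal_toReal hfx).symm⟩
  obtain ⟨a, ha, hAa⟩ : ∃ a : ℝ, 0 < a ∧ ∫⁻ y, f y ^ (4 / 3 : ℝ) = ENNReal.ofReal a :=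
    ⟨_, ENNReal.toReal_pos hA0 hA, (ENNReal.ofReal_toReal hA).symm⟩
  -- With c = f x and a = ∫ f^{4/3}, this radius balances the near part c r^{1/2} against the far
  -- part a^{3/4} r^{-1/4}; both become c^{1/3} a^{1/2}.
  set r : ℝ := a * c ^ (-(4 / 3) : ℝ) with hr
  have hr0 : 0 < r := by positivity
  set k₁ : ℝ → ℝ≥0∞ := {z : ℝ | |z| ≤ r}.indicator (fun z => ‖z‖ₑ ^ (-(1 / 2) : ℝ)) with hk₁
  set k₂ : ℝ → ℝ≥0∞ := {z : ℝ | |z| ≤ r}ᶜ.indicator (fun z => ‖z‖ₑ ^ (-(1 / 2) : ℝ)) with hk₂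
  have hset : MeasurableSet {z : ℝ | |z| ≤ r} := measurableSet_le (by fun_prop) (by fun_prop)
  have hm₁ : Measurable k₁ := Measurable.indicator (by fun_prop) hset
  have hm₂ : Measurable k₂ := Measurable.indicator (by fun_prop) hset.compl
  -- Near x the height bound f y ≤ f x is used; far from x the factor f y is kept for Hölder with
  -- exponents 4/3 and 4.
  have hpt : ∀ y, {y | f y ≤ f x}.indicator (fun y => f y * ‖x - y‖ₑ ^ (-(1 / 2) : ℝ)) y ≤
      f x * k₁ (x - y) + f y * k₂ (x - y) := by
    intro y
    by_cases hy : f y ≤ f x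
    · by_cases hz : |x - y| ≤ r
      · simp only [indicator, mem_ofPred_eq, hy, if_true, hk₁, hk₂, hz, mem_compl_iff, not_true,
          if_false, mul_zero, add_zero]
        gcongr
      · simp only [indicator, mem_ofPred_eq, hy, if_true, hk₁, hk₂, hz, mem_compl_iff,
          not_false_eq_true, if_false, mul_zero, zero_add, le_refl]
    · simp [indicator, hy]
  have hnear : ∫⁻ y, f x * k₁ (x - y) = ENNReal.ofReal (4 * (c ^ (1 / 3 : ℝ) * a ^ (1 / 2 : ℝ))) := by
    rw [lintegral_const_mul _ (by fun_prop), lintegral_sub_left_eq_self k₁ x,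
      lintegral_rpow_neg_half_near hr0, hfc, ← ENNReal.ofReal_mul hc.le, hr,
      Real.mul_rpow ha.le (by positivity), ← Real.rpow_mul hc.le]
    congr 1
    have : c ^ (1 / 3 : ℝ) = c * c ^ (-(4 / 3) * (1 / 2) : ℝ) := by
      rw [← Real.rpow_one_add' hc.le (by norm_num)]; norm_num
    rw [this]; ring
  have hfar : ∫⁻ y, f y * k₂ (x - y) ≤ ENNReal.ofReal (2 * (c ^ (1 / 3 : ℝ) * a ^ (1 / 2 : ℝ))) := by
    have hh := ENNReal.lintegral_mul_le_Lp_mul_Lq volume (p := 4 / 3) (q := 4)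
      (Real.holderConjugate_iff.2 ⟨by norm_num, by norm_num⟩) (f := f)
      (g := fun y => k₂ (x - y)) hf.aemeasurable (by fun_prop)
    refine hh.trans ?_
    have h4 : ∫⁻ y, k₂ (x - y) ^ (4 : ℝ) = ENNReal.ofReal (2 / r) := by
      rw [lintegral_sub_left_eq_self (fun y => k₂ y ^ (4 : ℝ)) x, ← lintegral_rpow_neg_two_far hr0]
      congr 1
      ext z
      by_cases hz : |z| ≤ r
      · simp [hk₂, indicator, hz]
      · simp only [hk₂, indicator, mem_compl_iff, mem_ofPred_eq, hz, not_false_eq_true, if_true,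
          ← ENNReal.rpow_mul]
        norm_num
    rw [h4, hAa, ENNReal.ofReal_rpow_of_pos ha, ENNReal.ofReal_rpow_of_pos (by positivity),
      ← ENNReal.ofReal_mul (by positivity)]
    apply ENNReal.ofReal_le_ofReal
    have e1 : 2 / r = 2 * (a⁻¹ * c ^ (4 / 3 : ℝ)) := by
      rw [hr, Real.rpow_neg hc.le]; field_simp
    have e2 : (2 : ℝ) ^ (1 / 4 : ℝ) ≤ 2 := by
      calc (2 : ℝ) ^ (1 / 4 : ℝ) ≤ 2 ^ (1 : ℝ) :=
            Real.rpow_le_rpow_of_exponent_le (by norm_num) (by norm_num)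
        _ = 2 := Real.rpow_one _
    have e3 : a ^ (1 / (4 / 3) : ℝ) * (2 / r) ^ (1 / 4 : ℝ) =
        2 ^ (1 / 4 : ℝ) * (c ^ (1 / 3 : ℝ) * a ^ (1 / 2 : ℝ)) := by
      rw [e1, Real.mul_rpow (by norm_num) (by positivity), Real.mul_rpow (by positivity)
        (by positivity), ← Real.rpow_mul hc.le, Real.inv_rpow ha.le, ← Real.rpow_neg ha.le]
      have : a ^ (1 / 2 : ℝ) = a ^ (1 / (4 / 3) : ℝ) * a ^ (-(1 / 4) : ℝ) := by
        rw [← Real.rpow_add ha]; norm_num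
      rw [this]
      norm_num
      ring
    rw [e3]
    gcongr
  calc _ ≤ ∫⁻ y, (f x * k₁ (x - y) + f y * k₂ (x - y)) := lintegral_mono hpt
    _ = (∫⁻ y, f x * k₁ (x - y)) + ∫⁻ y, f y * k₂ (x - y) := lintegral_add_left (by fun_prop) _
    _ ≤ _ := add_le_add hnear.le hfar
    _ = _ := by
      rw [hfc, hAa, ENNReal.ofReal_rpow_of_pos hc, ENNReal.ofReal_rpow_of_pos ha, mul_assoc,
        ← ENNReal.ofReal_mul (by positivity), ← ENNReal.ofReal_add (by positivity) (by positivity),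
        ← ENNReal.ofReal_ofNat 6, ← ENNReal.ofReal_mul (by norm_num)]
      congr 1
      ring

/-- The diagonal Hardy–Littlewood–Sobolev inequality on the line with kernel `|x - y|^{-1/2}`. -/
lemma hardy_littlewood_sobolev_half {f : ℝ → ℝ≥0∞} (hf : Measurable f) (hfin : ∀ x, f x ≠ ∞)
    (hA : ∫⁻ y, f y ^ (4 / 3 : ℝ) ≠ ∞) :
    ∫⁻ x, ∫⁻ y, f x * f y * ‖x - y‖ₑ ^ (-(1 / 2) : ℝ) ≤
      12 * (∫⁻ y, f y ^ (4 / 3 : ℝ)) ^ (3 / 2 : ℝ) := by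
  set A := ∫⁻ y, f y ^ (4 / 3 : ℝ) with hAdef
  set H : ℝ → ℝ → ℝ≥0∞ := fun x y =>
    f x * {y | f y ≤ f x}.indicator (fun y => f y * ‖x - y‖ₑ ^ (-(1 / 2) : ℝ)) y with hH
  have hHm : Measurable (Function.uncurry H) := by
    have hs : MeasurableSet {p : ℝ × ℝ | f p.2 ≤ f p.1} :=
      measurableSet_le (by fun_prop) (by fun_prop)
    have : Function.uncurry H = fun p => f p.1 * {p : ℝ × ℝ | f p.2 ≤ f p.1}.indicator
        (fun p => f p.2 * ‖p.1 - p.2‖ₑ ^ (-(1 / 2) : ℝ)) p := by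
      ext p; simp [Function.uncurry, hH, indicator]
    rw [this]
    exact (hf.comp measurable_fst).mul (Measurable.indicator (by fun_prop) hs)
  -- By symmetry each pair is charged to the point where f is larger. The inner integral over lower
  -- values then costs f x^{1/3}, and f x · f x^{1/3} is integrable, so no interpolation theorem is
  -- needed.
  have hpt : ∀ x y, f x * f y * ‖x - y‖ₑ ^ (-(1 / 2) : ℝ) ≤ H x y + H y x := by
    intro x y
    rcases le_total (f y) (f x) with h | h
    · refine le_trans (le_of_eq ?_) le_self_add
      simp [hH, indicator, h, mul_assoc]
    · refine le_trans (le_of_eq ?_) le_add_self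
      simp only [hH, indicator, mem_ofPred_eq, h, if_true, enorm_sub_rev y x]
      ring
  have hmain : ∫⁻ x, ∫⁻ y, H x y ≤ 6 * A ^ (3 / 2 : ℝ) := by
    have hx : ∀ x, ∫⁻ y, H x y ≤ f x ^ (4 / 3 : ℝ) * (6 * A ^ (1 / 2 : ℝ)) := by
      intro x
      simp only [hH]
      rw [lintegral_const_mul' _ _ (hfin x)]
      refine (mul_le_mul_right (fractional_integral_below_le hf x (hfin x) hA) _).trans_eq ?_
      rw [← hAdef, show (4 / 3 : ℝ) = 1 + 1 / 3 by norm_num,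
        ENNReal.rpow_add_of_nonneg _ _ (by norm_num) (by norm_num), ENNReal.rpow_one]
      ring
    refine (lintegral_mono hx).trans_eq ?_
    rw [lintegral_mul_const _ (by fun_prop), ← hAdef, show (3 / 2 : ℝ) = 1 + 1 / 2 by norm_num,
      ENNReal.rpow_add_of_nonneg _ _ (by norm_num) (by norm_num), ENNReal.rpow_one]
    ring
  calc _ ≤ ∫⁻ x, ∫⁻ y, (H x y + H y x) := lintegral_mono fun x => lintegral_mono (hpt x)
    _ = ∫⁻ x, ((∫⁻ y, H x y) + ∫⁻ y, H y x) :=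
        lintegral_congr fun x => lintegral_add_left (hHm.of_uncurry_left) _
    _ = (∫⁻ x, ∫⁻ y, H x y) + ∫⁻ x, ∫⁻ y, H y x :=
        lintegral_add_left hHm.lintegral_prod_right _
    _ = (∫⁻ x, ∫⁻ y, H x y) + ∫⁻ x, ∫⁻ y, H x y := by
        rw [lintegral_lintegral_swap (f := fun x y => H y x)]
        exact (hHm.comp measurable_swap).aemeasurable
    _ ≤ 6 * A ^ (3 / 2 : ℝ) + 6 * A ^ (3 / 2 : ℝ) := add_le_add hmain hmain
    _ = _ := by ring

/-- Schur's test for a convolution kernel. -/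
lemma lintegral_lintegral_mul_mul_sub_le {f k : ℝ → ℝ≥0∞} (hf : Measurable f) (hk : Measurable k)
    (hev : ∀ z, k (-z) = k z) :
    ∫⁻ x, ∫⁻ y, f x * f y * k (x - y) ≤ 2 * (∫⁻ z, k z) * ∫⁻ x, f x ^ 2 := by
  -- The product is at most the larger of the two squares; evenness of k makes the two resulting
  -- integrals equal.
  have hpt : ∀ x y, f x * f y * k (x - y) ≤ f x ^ 2 * k (x - y) + f y ^ 2 * k (x - y) := by
    intro x y
    rw [← add_mul]
    gcongr
    rcases le_total (f x) (f y) with h | h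
    · exact le_add_left (by rw [sq]; gcongr)
    · exact le_add_right (by rw [sq]; gcongr)
  have h1 : ∫⁻ x, ∫⁻ y, f x ^ 2 * k (x - y) = (∫⁻ z, k z) * ∫⁻ x, f x ^ 2 := by
    have : ∀ x, ∫⁻ y, f x ^ 2 * k (x - y) = f x ^ 2 * ∫⁻ z, k z := fun x => by
      rw [lintegral_const_mul _ (by fun_prop), lintegral_sub_left_eq_self k x]
    simp_rw [this]
    rw [lintegral_mul_const _ (by fun_prop), mul_comm]
  have h2 : ∫⁻ x, ∫⁻ y, f y ^ 2 * k (x - y) = (∫⁻ z, k z) * ∫⁻ x, f x ^ 2 := by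
    rw [lintegral_lintegral_swap (by fun_prop), ← h1]
    refine lintegral_congr fun x => lintegral_congr fun y => ?_
    rw [← hev (x - y), neg_sub]
  calc _ ≤ ∫⁻ x, ∫⁻ y, (f x ^ 2 * k (x - y) + f y ^ 2 * k (x - y)) :=
        lintegral_mono fun x => lintegral_mono (hpt x)
    _ = ∫⁻ x, ((∫⁻ y, f x ^ 2 * k (x - y)) + ∫⁻ y, f y ^ 2 * k (x - y)) :=
        lintegral_congr fun x => lintegral_add_left (by fun_prop) _
    _ = (∫⁻ x, ∫⁻ y, f x ^ 2 * k (x - y)) + ∫⁻ x, ∫⁻ y, f y ^ 2 * k (x - y) :=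
        lintegral_add_left (Measurable.lintegral_prod_right (by fun_prop)) _
    _ = _ := by rw [h1, h2]; ring

lemma sq_lintegral_mul_le {f g : ℝ → ℝ≥0∞} (hf : AEMeasurable f) (hg : AEMeasurable g) :
    (∫⁻ x, f x * g x) ^ 2 ≤ (∫⁻ x, f x ^ 2) * ∫⁻ x, g x ^ 2 := by
  have h := ENNReal.lintegral_mul_le_Lp_mul_Lq volume (p := 2) (q := 2)
    (Real.holderConjugate_iff.2 ⟨by norm_num, by norm_num⟩) hf hg
  calc _ ≤ ((∫⁻ x, f x ^ (2 : ℝ)) ^ (1 / 2 : ℝ) * (∫⁻ x, g x ^ (2 : ℝ)) ^ (1 / 2 : ℝ)) ^ 2 := by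
        gcongr; exact h
    _ = _ := by
        rw [mul_pow, ← ENNReal.rpow_two, ← ENNReal.rpow_two, ← ENNReal.rpow_mul,
          ← ENNReal.rpow_mul]
        norm_num

/-! ### The `T T*` argument with a Gaussian weight -/

lemma measurable_phase_comp {α : Type*} [MeasurableSpace α] {f g h : α → ℝ} (hf : Measurable f)
    (hg : Measurable g) (hh : Measurable h) : Measurable fun a => phase (f a) (g a) (h a) :=
  continuous_phase.measurable.comp (hf.prodMk (hg.prodMk hh))

/-- The adjoint of the linearized maximal operator: `W(ξ) = ∫ e^{i(xξ - t(x)ξ²)} w(x) dx`. -/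
noncomputable def adjointIntegral (t : ℝ → ℝ) (w : ℝ → ℂ) (ξ : ℝ) : ℂ :=
  ∫ x : ℝ, phase x (t x) ξ * w x

lemma stronglyMeasurable_adjointIntegral {t : ℝ → ℝ} (ht : Measurable t) {w : ℝ → ℂ}
    (hw : Measurable w) : StronglyMeasurable (adjointIntegral t w) := by
  refine StronglyMeasurable.integral_prod_right (ν := volume)
    (f := fun ξ x => phase x (t x) ξ * w x) ?_
  refine Measurable.stronglyMeasurable ?_
  exact (measurable_phase_comp measurable_snd (ht.comp measurable_snd) measurable_fst).mul
    (hw.comp measurable_snd)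

lemma norm_adjointIntegral_le (t : ℝ → ℝ) (w : ℝ → ℂ) (ξ : ℝ) :
    ‖adjointIntegral t w ξ‖ ≤ ∫ x, ‖w x‖ := by
  refine (norm_integral_le_integral_norm _).trans_eq ?_
  simp [norm_phase]

/-- Expanding |W|² as a double integral over (x, y) and integrating in ξ first produces the kernel.
Fubini applies because the Gaussian and w are integrable and the phases are unimodular. -/
lemma lintegral_gaussian_mul_adjointIntegral_sq_le {a : ℝ} (ha : 0 < a) {t : ℝ → ℝ}
    (ht : Measurable t) {w : ℝ → ℂ} (hwm : Measurable w) (hw : Integrable w) :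
    ∫⁻ ξ, ‖(Real.exp (-(a / 2) * ξ ^ 2) : ℂ) * adjointIntegral t w ξ‖ₑ ^ 2 ≤
      ∫⁻ x, ∫⁻ y, ‖w x‖ₑ * ‖w y‖ₑ *
        ‖∫ ξ : ℝ, phase (x - y) (t x - t y) ξ * (Real.exp (-a * ξ ^ 2) : ℂ)‖ₑ := by
  set W := adjointIntegral t w with hW
  have hWm : StronglyMeasurable W := stronglyMeasurable_adjointIntegral ht hwm
  have hgauss : Integrable fun ξ : ℝ => Real.exp (-a * ξ ^ 2) := integrable_exp_neg_mul_sq ha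
  have hint : Integrable fun ξ : ℝ => Real.exp (-a * ξ ^ 2) * ‖W ξ‖ ^ 2 := by
    refine hgauss.mul_bdd (c := (∫ x, ‖w x‖) ^ 2) ?_ (ae_of_all _ fun ξ => ?_)
    · exact (hWm.norm.pow 2).aestronglyMeasurable
    · rw [norm_pow, norm_norm]
      gcongr
      exact norm_adjointIntegral_le t w ξ
  have h1 : ∀ ξ : ℝ, ‖(Real.exp (-(a / 2) * ξ ^ 2) : ℂ) * W ξ‖ₑ ^ 2 =
      ENNReal.ofReal (Real.exp (-a * ξ ^ 2) * ‖W ξ‖ ^ 2) := fun ξ => by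
    rw [← ofReal_norm, ← ENNReal.ofReal_pow (norm_nonneg _), norm_mul, mul_pow,
      Complex.norm_real, Real.norm_of_nonneg (Real.exp_pos _).le, ← Real.exp_nat_mul]
    congr 3
    push_cast
    ring
  have h2 : ∀ ξ : ℝ, ((Real.exp (-a * ξ ^ 2) * ‖W ξ‖ ^ 2 : ℝ) : ℂ) =
      ∫ p : ℝ × ℝ, w p.1 * (starRingEnd ℂ) (w p.2) *
        (phase (p.1 - p.2) (t p.1 - t p.2) ξ * (Real.exp (-a * ξ ^ 2) : ℂ)) := fun ξ => by
    have h3 : ((‖W ξ‖ ^ 2 : ℝ) : ℂ) = W ξ * (starRingEnd ℂ) (W ξ) := by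
      rw [Complex.mul_conj, Complex.normSq_eq_norm_sq]
    rw [Complex.ofReal_mul, h3, hW, adjointIntegral, ← integral_conj, Measure.volume_eq_prod,
      ← integral_prod_mul, ← integral_const_mul]
    refine integral_congr_ae (ae_of_all _ fun p => ?_)
    simp only [map_mul, ← phase_mul_conj]
    ring
  have hprod : Integrable fun p : ℝ × ℝ => w p.1 * (starRingEnd ℂ) (w p.2) :=
    hw.mul_prod (Complex.conjLIE.integrable_comp_iff.2 hw)
  have htriple : Integrable (Function.uncurry fun (ξ : ℝ) (p : ℝ × ℝ) =>
      w p.1 * (starRingEnd ℂ) (w p.2) *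
        (phase (p.1 - p.2) (t p.1 - t p.2) ξ * (Real.exp (-a * ξ ^ 2) : ℂ)))
      (volume.prod volume) := by
    have hm := hgauss.ofReal (𝕜 := ℂ).mul_prod hprod
    have hb := hm.bdd_mul (c := 1) (f := fun q : ℝ × ℝ × ℝ =>
      phase (q.2.1 - q.2.2) (t q.2.1 - t q.2.2) q.1) (by
        refine (measurable_phase_comp ?_ ?_ ?_).aestronglyMeasurable <;> fun_prop)
      (ae_of_all _ fun q => (norm_phase _ _ _).le)
    refine hb.congr (ae_of_all _ fun q => ?_)
    simp only [Function.uncurry]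
    simp
    ring
  simp_rw [h1]
  rw [← ofReal_integral_eq_lintegral_ofReal hint (ae_of_all _ fun ξ => by positivity)]
  have h4 : ENNReal.ofReal (∫ ξ : ℝ, Real.exp (-a * ξ ^ 2) * ‖W ξ‖ ^ 2) =
      ‖∫ ξ : ℝ, ((Real.exp (-a * ξ ^ 2) * ‖W ξ‖ ^ 2 : ℝ) : ℂ)‖ₑ := by
    rw [integral_complex_ofReal, ← ofReal_norm, Complex.norm_real, Real.norm_of_nonneg]
    exact integral_nonneg fun ξ => by positivity
  rw [h4]
  simp_rw [h2]
  rw [integral_integral_swap htriple]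
  refine (enorm_integral_le_lintegral_enorm _).trans ?_
  have h5 : ∀ p : ℝ × ℝ, ‖∫ ξ : ℝ, w p.1 * (starRingEnd ℂ) (w p.2) *
        (phase (p.1 - p.2) (t p.1 - t p.2) ξ * (Real.exp (-a * ξ ^ 2) : ℂ))‖ₑ =
      ‖w p.1‖ₑ * ‖w p.2‖ₑ *
        ‖∫ ξ : ℝ, phase (p.1 - p.2) (t p.1 - t p.2) ξ * (Real.exp (-a * ξ ^ 2) : ℂ)‖ₑ := by
    intro p
    rw [integral_const_mul, enorm_mul, enorm_mul, RCLike.enorm_conj]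
  simp_rw [h5]
  rw [Measure.volume_eq_prod]
  exact lintegral_prod_le _

/-- The `T T*` estimate for the propagator along a measurable choice of times. -/
lemma enorm_integral_waveIntegral_mul_sq_le {a : ℝ} (ha : 0 < a) {t : ℝ → ℝ}
    (ht : Measurable t) {w : ℝ → ℂ} (hwm : Measurable w) (hw : Integrable w) {h : ℝ → ℂ}
    (hhm : Measurable h) (hh : MemLp h 2) :
    ‖∫ x, waveIntegral (fun ξ => (Real.exp (-(a / 2) * ξ ^ 2) : ℂ) * h ξ) x (t x) * w x‖ₑ ^ 2 ≤
      (∫⁻ ξ, ‖h ξ‖ₑ ^ 2) * ∫⁻ x, ∫⁻ y, ‖w x‖ₑ * ‖w y‖ₑ *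
        ‖∫ ξ : ℝ, phase (x - y) (t x - t y) ξ * (Real.exp (-a * ξ ^ 2) : ℂ)‖ₑ := by
  set e : ℝ → ℂ := fun ξ => (Real.exp (-(a / 2) * ξ ^ 2) : ℂ) with he
  have hem : Measurable e := by fun_prop
  have heL2 : MemLp e 2 := by
    rw [memLp_two_iff_integrable_sq_norm hem.aestronglyMeasurable]
    refine (integrable_exp_neg_mul_sq ha).congr (ae_of_all _ fun ξ => ?_)
    simp only [he]
    rw [Complex.norm_real, Real.norm_of_nonneg (Real.exp_pos _).le, ← Real.exp_nat_mul]
    congr 1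
    push_cast
    ring
  have hehL1 : Integrable fun ξ => e ξ * h ξ := heL2.integrable_mul hh
  have hswap : Integrable (Function.uncurry fun x ξ : ℝ => phase x (t x) ξ * (e ξ * h ξ) * w x)
      (volume.prod volume) := by
    have hb := (hw.mul_prod hehL1).bdd_mul (c := 1) (f := fun q : ℝ × ℝ =>
      phase q.1 (t q.1) q.2) (by
        refine (measurable_phase_comp ?_ ?_ ?_).aestronglyMeasurable <;> fun_prop)
      (ae_of_all _ fun q => (norm_phase _ _ _).le)
    refine hb.congr (ae_of_all _ fun q => ?_)
    simp only [Function.uncurry]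
    ring
  -- Duality: the test function is moved onto the frequency side, after which Cauchy–Schwarz
  -- separates h from the adjoint.
  have h1 : ∫ x, waveIntegral (fun ξ => e ξ * h ξ) x (t x) * w x =
      ∫ ξ, h ξ * (e ξ * adjointIntegral t w ξ) := by
    simp only [waveIntegral, ← integral_mul_const]
    rw [integral_integral_swap hswap]
    refine integral_congr_ae (ae_of_all _ fun ξ => ?_)
    simp only [adjointIntegral, ← integral_const_mul]
    refine integral_congr_ae (ae_of_all _ fun x => ?_)
    ring
  have hWm := (stronglyMeasurable_adjointIntegral ht hwm).measurable
  rw [h1]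
  calc _ ≤ (∫⁻ ξ, ‖h ξ * (e ξ * adjointIntegral t w ξ)‖ₑ) ^ 2 := by
        gcongr; exact enorm_integral_le_lintegral_enorm _
    _ = (∫⁻ ξ, ‖h ξ‖ₑ * ‖e ξ * adjointIntegral t w ξ‖ₑ) ^ 2 := by simp_rw [enorm_mul]
    _ ≤ (∫⁻ ξ, ‖h ξ‖ₑ ^ 2) * ∫⁻ ξ, ‖e ξ * adjointIntegral t w ξ‖ₑ ^ 2 :=
        sq_lintegral_mul_le (by fun_prop) (by fun_prop)
    _ ≤ _ := by
        exact mul_le_mul_right (lintegral_gaussian_mul_adjointIntegral_sq_le ha ht hwm hw) _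

lemma norm_waveIntegral_le (g : ℝ → ℂ) (x t : ℝ) : ‖waveIntegral g x t‖ ≤ ∫ ξ, ‖g ξ‖ := by
  refine (norm_integral_le_integral_norm _).trans_eq ?_
  simp [norm_phase]

lemma measurable_waveIntegral {g : ℝ → ℂ} (hg : Measurable g) {t : ℝ → ℝ} (ht : Measurable t) :
    Measurable fun x => waveIntegral g x (t x) := by
  refine (StronglyMeasurable.integral_prod_right (ν := volume)
    (f := fun x ξ => phase x (t x) ξ * g ξ) ?_).measurable
  refine Measurable.stronglyMeasurable ?_
  exact (measurable_phase_comp measurable_fst (ht.comp measurable_fst) measurable_snd).mul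
    (hg.comp measurable_snd)

lemma continuous_waveIntegral {g : ℝ → ℂ} (hg : Integrable g) (x : ℝ) :
    Continuous fun t => waveIntegral g x t := by
  refine continuous_of_dominated (bound := fun ξ => ‖g ξ‖) (fun t => ?_)
    (fun t => ae_of_all _ fun ξ => ?_) hg.norm (ae_of_all _ fun ξ => ?_)
  · exact (measurable_phase_comp measurable_const measurable_const
      measurable_id).aestronglyMeasurable.mul hg.aestronglyMeasurable
  · simp [norm_phase]
  · unfold phase; fun_prop

/-! ### Linearized maximal estimates for band-limited data -/

/-- `g` is a measurable square integrable function vanishing off `[-4N, 4N]`. -/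
structure BandLimited (N : ℝ) (g : ℝ → ℂ) : Prop where
  pos : 0 < N
  measurable : Measurable g
  memLp : MemLp g 2
  ae_eq_zero : ∀ᵐ ξ : ℝ, 4 * N < |ξ| → g ξ = 0

section BandLimited

variable {N : ℝ} {g : ℝ → ℂ}

/-- Cauchy–Schwarz on an interval of length 8N, with √8 ≤ 3. -/
lemma BandLimited.lintegral_enorm_le (hg : BandLimited N g) :
    ∫⁻ ξ, ‖g ξ‖ₑ ≤ ENNReal.ofReal (3 * N ^ (1 / 2 : ℝ)) * (∫⁻ ξ, ‖g ξ‖ₑ ^ 2) ^ (1 / 2 : ℝ) := by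
  set B := Icc (-(4 * N)) (4 * N) with hB
  have hgm := hg.measurable
  have hN := hg.pos
  have h1 : ∫⁻ ξ, ‖g ξ‖ₑ = ∫⁻ ξ, B.indicator 1 ξ * ‖g ξ‖ₑ := by
    refine lintegral_congr_ae ?_
    filter_upwards [hg.ae_eq_zero] with ξ hξ
    by_cases h : ξ ∈ B
    · simp [h]
    · rw [hξ]
      · simp
      · by_contra h'
        exact h (abs_le.1 (not_lt.1 h'))
  have h2 := sq_lintegral_mul_le (f := B.indicator 1) (g := fun ξ => ‖g ξ‖ₑ)
    (Measurable.indicator measurable_one measurableSet_Icc).aemeasurable (by fun_prop)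
  have h3 : ∫⁻ ξ, B.indicator (1 : ℝ → ℝ≥0∞) ξ ^ 2 = ENNReal.ofReal (8 * N) := by
    have : ∀ ξ, B.indicator (1 : ℝ → ℝ≥0∞) ξ ^ 2 = B.indicator 1 ξ := fun ξ => by
      by_cases h : ξ ∈ B <;> simp [h]
    simp_rw [this]
    rw [lintegral_indicator_one measurableSet_Icc, Real.volume_Icc]
    congr 1; ring
  rw [← h1, h3] at h2
  have h4 : ((8 : ℝ) * N) ^ (1 / 2 : ℝ) ≤ 3 * N ^ (1 / 2 : ℝ) := by
    rw [Real.mul_rpow (by norm_num) hN.le]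
    gcongr
    rw [← Real.sqrt_eq_rpow]
    exact Real.sqrt_le_iff.2 ⟨by norm_num, by norm_num⟩
  calc ∫⁻ ξ, ‖g ξ‖ₑ = ((∫⁻ ξ, ‖g ξ‖ₑ) ^ 2) ^ (1 / 2 : ℝ) := by
        rw [← ENNReal.rpow_natCast, ← ENNReal.rpow_mul]; norm_num
    _ ≤ (ENNReal.ofReal (8 * N) * ∫⁻ ξ, ‖g ξ‖ₑ ^ 2) ^ (1 / 2 : ℝ) := by gcongr
    _ = ENNReal.ofReal ((8 * N) ^ (1 / 2 : ℝ)) * (∫⁻ ξ, ‖g ξ‖ₑ ^ 2) ^ (1 / 2 : ℝ) := by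
        rw [ENNReal.mul_rpow_of_nonneg _ _ (by norm_num),
          ENNReal.ofReal_rpow_of_pos (by positivity)]
    _ ≤ _ := by gcongr

lemma BandLimited.lintegral_sq_ne_top (hg : BandLimited N g) : ∫⁻ ξ, ‖g ξ‖ₑ ^ 2 ≠ ∞ := by
  have h := (lintegral_rpow_enorm_lt_top_of_eLpNorm_lt_top (by norm_num) (by norm_num)
    hg.memLp.eLpNorm_lt_top).ne
  simpa using h

lemma BandLimited.integrable (hg : BandLimited N g) : Integrable g := by
  refine ⟨hg.measurable.aestronglyMeasurable, ?_⟩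
  refine hg.lintegral_enorm_le.trans_lt (ENNReal.mul_lt_top ENNReal.ofReal_lt_top ?_)
  exact ENNReal.rpow_lt_top_of_nonneg (by norm_num) hg.lintegral_sq_ne_top

lemma BandLimited.enorm_waveIntegral_le (hg : BandLimited N g) (x t : ℝ) :
    ‖waveIntegral g x t‖ₑ ≤
      ENNReal.ofReal (3 * N ^ (1 / 2 : ℝ)) * (∫⁻ ξ, ‖g ξ‖ₑ ^ 2) ^ (1 / 2 : ℝ) := by
  refine (enorm_integral_le_lintegral_enorm _).trans (le_of_eq_of_le ?_ hg.lintegral_enorm_le)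
  refine lintegral_congr fun ξ => ?_
  rw [enorm_mul, ← ofReal_norm, norm_phase]
  simp

/-- The kernel of the `T T*` operator cut off at frequency `N`. -/
noncomputable def kernel (N x t : ℝ) : ℂ :=
  ∫ ξ : ℝ, phase x t ξ * (Real.exp (-(1 / N ^ 2) * ξ ^ 2) : ℂ)

/-- The `T T*` bound applies to data carrying a Gaussian factor, so g is first divided by
exp(-ξ²/(2N²)). On |ξ| ≤ 4N this costs at most e⁸, hence e¹⁶ in the squared norm. -/
lemma BandLimited.enorm_integral_mul_sq_le (hg : BandLimited N g) {t : ℝ → ℝ} (ht : Measurable t)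
    {w : ℝ → ℂ} (hwm : Measurable w) (hw : Integrable w) :
    ‖∫ x, waveIntegral g x (t x) * w x‖ₑ ^ 2 ≤
      ENNReal.ofReal (Real.exp 16) * (∫⁻ ξ, ‖g ξ‖ₑ ^ 2) *
        ∫⁻ x, ∫⁻ y, ‖w x‖ₑ * ‖w y‖ₑ * ‖kernel N (x - y) (t x - t y)‖ₑ := by
  have hN := hg.pos
  have hgm := hg.measurable
  set a := 1 / N ^ 2 with ha
  have ha0 : 0 < a := by positivity
  set h : ℝ → ℂ := fun ξ => (Real.exp (a / 2 * ξ ^ 2) : ℂ) * g ξ with hh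
  have hhm : Measurable h := by fun_prop
  have hle : ∀ᵐ ξ, ‖h ξ‖ ≤ Real.exp 8 * ‖g ξ‖ := by
    filter_upwards [hg.ae_eq_zero] with ξ hξ
    rcases lt_or_ge (4 * N) |ξ| with h4 | h4
    · simp [hh, hξ h4]
    · rw [hh, norm_mul, Complex.norm_real, Real.norm_of_nonneg (Real.exp_pos _).le]
      gcongr
      have : ξ ^ 2 ≤ (4 * N) ^ 2 := by
        rw [← sq_abs]; gcongr
      calc a / 2 * ξ ^ 2 ≤ a / 2 * (4 * N) ^ 2 := by gcongr
        _ = 8 := by rw [ha]; field_simp; norm_num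
  have hgh : g = fun ξ => (Real.exp (-(a / 2) * ξ ^ 2) : ℂ) * h ξ := by
    ext ξ
    rw [hh, ← mul_assoc, ← Complex.ofReal_mul, ← Real.exp_add]
    ring_nf
    simp
  have hL2 : MemLp h 2 := hg.memLp.of_le_mul hhm.aestronglyMeasurable hle
  have hnorm : ∫⁻ ξ, ‖h ξ‖ₑ ^ 2 ≤ ENNReal.ofReal (Real.exp 16) * ∫⁻ ξ, ‖g ξ‖ₑ ^ 2 := by
    rw [← lintegral_const_mul _ (by fun_prop)]
    refine lintegral_mono_ae ?_
    filter_upwards [hle] with ξ hξ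
    rw [← ofReal_norm, ← ofReal_norm, ← ENNReal.ofReal_pow (norm_nonneg _),
      ← ENNReal.ofReal_pow (norm_nonneg _), ← ENNReal.ofReal_mul (Real.exp_pos _).le]
    apply ENNReal.ofReal_le_ofReal
    calc ‖h ξ‖ ^ 2 ≤ (Real.exp 8 * ‖g ξ‖) ^ 2 := by gcongr
      _ = _ := by rw [mul_pow, ← Real.exp_nat_mul]; norm_num
  have key := enorm_integral_waveIntegral_mul_sq_le ha0 ht hwm hw hhm hL2
  rw [← hgh] at key
  refine key.trans ?_
  gcongr
  rfl

/-- Testing the linearized maximal function against its own powers on a bounded interval. -/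
lemma BandLimited.sq_setLIntegral_le (hg : BandLimited N g) {t : ℝ → ℝ} (ht : Measurable t)
    (m : ℕ) (R : ℝ) :
    ∃ f : ℝ → ℝ≥0∞, Measurable f ∧ (∀ x, f x ≠ ∞) ∧
      (f = (Icc (-R) R).indicator fun x => ‖waveIntegral g x (t x)‖ₑ ^ (m + 1)) ∧
      (∫⁻ x in Icc (-R) R, ‖waveIntegral g x (t x)‖ₑ ^ (m + 2) ≠ ∞) ∧
      (∫⁻ x in Icc (-R) R, ‖waveIntegral g x (t x)‖ₑ ^ (m + 2)) ^ 2 ≤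
        ENNReal.ofReal (Real.exp 16) * (∫⁻ ξ, ‖g ξ‖ₑ ^ 2) *
          ∫⁻ x, ∫⁻ y, f x * f y * ‖kernel N (x - y) (t x - t y)‖ₑ := by
  set B := Icc (-R) R with hB
  set G : ℝ → ℂ := fun x => waveIntegral g x (t x) with hG
  have hGm : Measurable G := measurable_waveIntegral hg.measurable ht
  set c := ∫ ξ, ‖g ξ‖ with hc
  have hGc : ∀ x, ‖G x‖ ≤ c := fun x => norm_waveIntegral_le g x (t x)
  -- Chosen so that G w = |G|^{m+2} and |w| = |G|^{m+1} on B. Truncating to a bounded interval keeps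
  -- the moment finite, which later allows cancelling it.
  set w : ℝ → ℂ := B.indicator fun x => (starRingEnd ℂ) (G x) * (‖G x‖ ^ m : ℝ) with hw
  have hwm : Measurable w := Measurable.indicator (by fun_prop) measurableSet_Icc
  have hBfin : volume B ≠ ∞ := by simp [hB]
  have hwi : Integrable w := by
    rw [hw, integrable_indicator_iff measurableSet_Icc]
    refine Measure.integrableOn_of_bounded (M := c * c ^ m) hBfin
      (Measurable.aestronglyMeasurable (by fun_prop)) (ae_of_all _ fun x => ?_)
    rw [norm_mul, RCLike.norm_conj, Complex.norm_real, norm_pow, norm_norm]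
    have := hGc x
    gcongr
  have hGi : IntegrableOn (fun x => ‖G x‖ ^ (m + 2)) B := by
    refine Measure.integrableOn_of_bounded (M := c ^ (m + 2)) hBfin
      (Measurable.aestronglyMeasurable (by fun_prop)) (ae_of_all _ fun x => ?_)
    rw [norm_pow, norm_norm]
    have := hGc x
    gcongr
  have hJ : ∫⁻ x in B, ‖G x‖ₑ ^ (m + 2) = ENNReal.ofReal (∫ x in B, ‖G x‖ ^ (m + 2)) := by
    rw [ofReal_integral_eq_lintegral_ofReal hGi (ae_of_all _ fun x => by positivity)]
    refine lintegral_congr fun x => ?_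
    rw [ENNReal.ofReal_pow (norm_nonneg _), ofReal_norm]
  have hGw : ‖∫ x, G x * w x‖ₑ = ∫⁻ x in B, ‖G x‖ₑ ^ (m + 2) := by
    have h1 : ∀ x, G x * w x = B.indicator (fun x => ((‖G x‖ ^ (m + 2) : ℝ) : ℂ)) x := fun x => by
      by_cases hx : x ∈ B
      · simp only [hw, indicator_of_mem hx]
        rw [← mul_assoc, Complex.mul_conj, Complex.normSq_eq_norm_sq, ← Complex.ofReal_mul]
        congr 1; ring
      · simp [hw, hx]
    simp_rw [h1]
    rw [integral_indicator measurableSet_Icc, integral_complex_ofReal, hJ, ← ofReal_norm,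
      Complex.norm_real, Real.norm_of_nonneg (integral_nonneg fun x => by positivity)]
  have hwn : (fun x => ‖w x‖ₑ) = B.indicator fun x => ‖G x‖ₑ ^ (m + 1) := by
    ext x
    by_cases hx : x ∈ B
    · simp only [hw, indicator_of_mem hx]
      rw [enorm_mul, RCLike.enorm_conj, ← ofReal_norm ((_ : ℝ) : ℂ), Complex.norm_real, norm_pow,
        norm_norm, ENNReal.ofReal_pow (norm_nonneg _), ofReal_norm, pow_succ']
    · simp [hw, hx]
  refine ⟨fun x => ‖w x‖ₑ, by fun_prop, fun x => enorm_ne_top, hwn, ?_, ?_⟩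
  · rw [hJ]; exact ENNReal.ofReal_ne_top
  · rw [← hGw]
    exact hg.enorm_integral_mul_sq_le ht hwm hwi

lemma lintegral_le_of_forall_setLIntegral_Icc_le {f : ℝ → ℝ≥0∞} (hf : Measurable f) {D : ℝ≥0∞}
    (h : ∀ R : ℝ, ∫⁻ x in Icc (-R) R, f x ≤ D) : ∫⁻ x, f x ≤ D :=
  le_of_tendsto' ((aecover_Icc Filter.tendsto_neg_atTop_atBot
    Filter.tendsto_id).lintegral_tendsto_of_countably_generated hf.aemeasurable) h

lemma enorm_kernel_le (hN : 0 < N) (x t : ℝ) :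
    ‖kernel N x t‖ₑ ≤ ENNReal.ofReal (4 * N ^ (1 / 2 : ℝ)) * ‖x‖ₑ ^ (-(1 / 2) : ℝ) :=
  gaussian_kernel_enorm_le hN x t

/-- An integrable majorant, uniform in `|t| ≤ 2`, of `kernel N x t`. -/
noncomputable def localMajorant (N x : ℝ) : ℝ≥0∞ :=
  ENNReal.ofReal (4 * N ^ (1 / 2 : ℝ)) *
      {z : ℝ | |z| ≤ N}.indicator (fun z => ‖z‖ₑ ^ (-(1 / 2) : ℝ)) x +
    ENNReal.ofReal (40 * N ^ 2) * {z : ℝ | |z| ≤ N}ᶜ.indicator (fun z => ‖z‖ₑ ^ (-2 : ℝ)) x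

lemma enorm_kernel_le_localMajorant (hN : 1 ≤ N) (x : ℝ) {t : ℝ} (ht : |t| ≤ 2) :
    ‖kernel N x t‖ₑ ≤ localMajorant N x := by
  by_cases hx : |x| ≤ N
  · simpa [localMajorant, indicator, hx] using enorm_kernel_le (by linarith) x t
  · have h := gaussian_kernel_enorm_le_of_far hN x ht
    rw [← kernel] at h
    simpa [localMajorant, indicator, hx] using h

lemma localMajorant_neg (x : ℝ) : localMajorant N (-x) = localMajorant N x := by
  simp [localMajorant, indicator]

lemma measurable_localMajorant : Measurable (localMajorant N) := by
  have hset : MeasurableSet {z : ℝ | |z| ≤ N} := measurableSet_le (by fun_prop) (by fun_prop)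
  unfold localMajorant
  exact ((Measurable.indicator (by fun_prop) hset).const_mul _).add
    ((Measurable.indicator (by fun_prop) hset.compl).const_mul _)

lemma lintegral_localMajorant (hN : 0 < N) :
    ∫⁻ x, localMajorant N x = ENNReal.ofReal (96 * N) := by
  have hset : MeasurableSet {z : ℝ | |z| ≤ N} := measurableSet_le (by fun_prop) (by fun_prop)
  unfold localMajorant
  rw [lintegral_add_left ((Measurable.indicator (by fun_prop) hset).const_mul _),
    lintegral_const_mul _ (Measurable.indicator (by fun_prop) hset),
    lintegral_const_mul _ (Measurable.indicator (by fun_prop) hset.compl),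
    lintegral_rpow_neg_half_near hN, lintegral_rpow_neg_two_far hN,
    ← ENNReal.ofReal_mul (by positivity), ← ENNReal.ofReal_mul (by positivity),
    ← ENNReal.ofReal_add (by positivity) (by positivity)]
  -- The near part contributes 4 · 4 N = 16 N and the far part 40 N² · 2/N = 80 N.
  congr 1
  have : N ^ (1 / 2 : ℝ) * N ^ (1 / 2 : ℝ) = N := by
    rw [← Real.sqrt_eq_rpow, Real.mul_self_sqrt hN.le]
  field_simp
  nlinarith

/-- The linearized local-in-time maximal estimate in `L²`. -/
lemma BandLimited.lintegral_sq_le (hg : BandLimited N g) (hN : 1 ≤ N) {t : ℝ → ℝ}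
    (ht : Measurable t) (ht1 : ∀ x, t x ∈ Icc (-1 : ℝ) 1) :
    ∫⁻ x, ‖waveIntegral g x (t x)‖ₑ ^ 2 ≤
      ENNReal.ofReal (192 * Real.exp 16 * N) * ∫⁻ ξ, ‖g ξ‖ₑ ^ 2 := by
  have hGm := measurable_waveIntegral hg.measurable ht
  refine lintegral_le_of_forall_setLIntegral_Icc_le (by fun_prop) fun R => ?_
  obtain ⟨f, hfm, -, hf, hJ, h⟩ := hg.sq_setLIntegral_le ht 0 R
  simp only [zero_add] at hJ h hf
  set J := ∫⁻ x in Icc (-R) R, ‖waveIntegral g x (t x)‖ₑ ^ 2 with hJdef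
  have hf2 : ∫⁻ x, f x ^ 2 = J := by
    rw [hJdef, ← lintegral_indicator measurableSet_Icc]
    refine lintegral_congr fun x => ?_
    by_cases hx : x ∈ Icc (-R) R <;> simp [hf, hx]
  have hker : ∫⁻ x, ∫⁻ y, f x * f y * ‖kernel N (x - y) (t x - t y)‖ₑ ≤
      2 * ENNReal.ofReal (96 * N) * J := by
    rw [← hf2, ← lintegral_localMajorant hg.pos]
    refine le_trans (lintegral_mono fun x => lintegral_mono fun y => ?_)
      (lintegral_lintegral_mul_mul_sub_le hfm measurable_localMajorant localMajorant_neg)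
    refine mul_le_mul_right (enorm_kernel_le_localMajorant hN _ ?_) _
    rw [abs_le]
    constructor <;> linarith [(ht1 x).1, (ht1 x).2, (ht1 y).1, (ht1 y).2]
  rcases eq_or_ne J 0 with h0 | h0
  · rw [h0]; exact zero_le
  -- The estimate has the form J² ≤ C J; finiteness of J permits division.
  rw [← ENNReal.mul_le_mul_iff_left h0 hJ, ← sq]
  refine (h.trans (mul_le_mul_right hker _)).trans_eq ?_
  rw [show (192 * Real.exp 16 * N) = Real.exp 16 * (2 * (96 * N)) by ring,
    ENNReal.ofReal_mul (p := Real.exp 16) (by positivity),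
      ENNReal.ofReal_mul (p := 2) (by norm_num),
    ENNReal.ofReal_ofNat]
  ring

/-- The linearized global maximal estimate in `L⁴`. -/
lemma BandLimited.lintegral_pow_four_le (hg : BandLimited N g) {t : ℝ → ℝ} (ht : Measurable t) :
    ∫⁻ x, ‖waveIntegral g x (t x)‖ₑ ^ 4 ≤
      ENNReal.ofReal ((48 * Real.exp 16) ^ 2 * N) * (∫⁻ ξ, ‖g ξ‖ₑ ^ 2) ^ 2 := by
  have hN := hg.pos
  have hGm := measurable_waveIntegral hg.measurable ht
  refine lintegral_le_of_forall_setLIntegral_Icc_le (by fun_prop) fun R => ?_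
  obtain ⟨f, hfm, hfin, hf, hJ, h⟩ := hg.sq_setLIntegral_le ht 2 R
  norm_num at hJ h hf
  set J := ∫⁻ x in Icc (-R) R, ‖waveIntegral g x (t x)‖ₑ ^ 4 with hJdef
  set U := ∫⁻ ξ, ‖g ξ‖ₑ ^ 2 with hU
  have hf2 : ∫⁻ x, f x ^ (4 / 3 : ℝ) = J := by
    rw [hJdef, ← lintegral_indicator measurableSet_Icc]
    refine lintegral_congr fun x => ?_
    by_cases hx : x ∈ Icc (-R) R
    · simp only [hf, indicator_of_mem hx]
      rw [← ENNReal.rpow_natCast, ← ENNReal.rpow_mul, ← ENNReal.rpow_natCast]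
      norm_num
    · simp [hf, hx]
  have hker : ∫⁻ x, ∫⁻ y, f x * f y * ‖kernel N (x - y) (t x - t y)‖ₑ ≤
      ENNReal.ofReal (4 * N ^ (1 / 2 : ℝ)) * (12 * J ^ (3 / 2 : ℝ)) := by
    rw [← hf2] at hJ ⊢
    refine le_trans ?_ (mul_le_mul_right (hardy_littlewood_sobolev_half hfm hfin hJ) _)
    rw [← lintegral_const_mul' _ _ ENNReal.ofReal_ne_top]
    refine lintegral_mono fun x => ?_
    rw [← lintegral_const_mul' _ _ ENNReal.ofReal_ne_top]
    refine lintegral_mono fun y => ?_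
    refine (mul_le_mul_right (enorm_kernel_le hN _ _) _).trans_eq ?_
    ring
  rcases eq_or_ne J 0 with h0 | h0
  · rw [h0]; exact zero_le
  -- Here f^{4/3} = |G|⁴ on the interval, so the inequality reads J² ≤ C J^{3/2}, and J^{3/2} is
  -- cancelled.
  have h1 : J ^ (1 / 2 : ℝ) ≤ ENNReal.ofReal (48 * Real.exp 16 * N ^ (1 / 2 : ℝ)) * U := by
    have hp0 : J ^ (3 / 2 : ℝ) ≠ 0 := by
      simp [ENNReal.rpow_eq_zero_iff, h0, hJ]
    have hpt : J ^ (3 / 2 : ℝ) ≠ ∞ := ENNReal.rpow_ne_top_of_nonneg (by norm_num) hJ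
    rw [← ENNReal.mul_le_mul_iff_left hp0 hpt,
      ← ENNReal.rpow_add_of_nonneg _ _ (by norm_num) (by norm_num)]
    norm_num
    refine (h.trans (mul_le_mul_right hker _)).trans_eq ?_
    rw [show (48 * Real.exp 16 * N ^ (1 / 2 : ℝ)) = Real.exp 16 * (12 * (4 * N ^ (1 / 2 : ℝ))) by
      ring, ENNReal.ofReal_mul (p := Real.exp 16) (by positivity),
      ENNReal.ofReal_mul (p := 12) (by norm_num),
      ENNReal.ofReal_ofNat]
    ring
  calc J = (J ^ (1 / 2 : ℝ)) ^ 2 := by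
        rw [← ENNReal.rpow_natCast, ← ENNReal.rpow_mul]; norm_num
    _ ≤ (ENNReal.ofReal (48 * Real.exp 16 * N ^ (1 / 2 : ℝ)) * U) ^ 2 := by gcongr
    _ = _ := by
        rw [mul_pow, ← ENNReal.ofReal_pow (by positivity), mul_pow, ← Real.sqrt_eq_rpow,
          Real.sq_sqrt hN.le]

end BandLimited

/-! ### Maximal functions and measurable choices of time -/

/-- The maximal function `sup_{t ∈ S} |F(x, t)|`. -/
noncomputable def maximal (S : Set ℝ) (F : ℝ → ℝ → ℂ) (x : ℝ) : ℝ≥0∞ := ⨆ t : S, ‖F x t‖ₑ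

lemma enorm_le_maximal {S : Set ℝ} (F : ℝ → ℝ → ℂ) (x : ℝ) {t : ℝ} (ht : t ∈ S) :
    ‖F x t‖ₑ ≤ maximal S F x :=
  le_iSup (fun t : S => ‖F x t‖ₑ) ⟨t, ht⟩

/-- Continuity in t reduces the supremum to countably many times, which is what makes measurability
and selection possible. -/
lemma maximal_eq_iSup_denseSeq {S : Set ℝ} [Nonempty S] {F : ℝ → ℝ → ℂ} (x : ℝ)
    (hF : Continuous (F x)) :
    maximal S F x = ⨆ n, ‖F x (TopologicalSpace.denseSeq S n)‖ₑ := by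
  refine le_antisymm (iSup_le fun t => ?_) (iSup_le fun n => enorm_le_maximal F x (Subtype.coe_prop _))
  have hcl : IsClosed {t : S | ‖F x t‖ₑ ≤ ⨆ n, ‖F x (TopologicalSpace.denseSeq S n)‖ₑ} :=
    isClosed_le (by fun_prop) continuous_const
  exact (TopologicalSpace.denseRange_denseSeq S).induction_on t hcl
    fun n => le_iSup (fun n => ‖F x (TopologicalSpace.denseSeq S n)‖ₑ) n

lemma measurable_maximal {S : Set ℝ} [Nonempty S] {F : ℝ → ℝ → ℂ} (hF : ∀ x, Continuous (F x))
    (hFm : ∀ t, Measurable fun x => F x t) : Measurable (maximal S F) := by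
  have : maximal S F = fun x => ⨆ n, ‖F x (TopologicalSpace.denseSeq S n)‖ₑ :=
    funext fun x => maximal_eq_iSup_denseSeq x (hF x)
  rw [this]
  exact Measurable.iSup fun n => (hFm _).enorm

/-- Measurable choices of times along which `F` increases to its maximal function. -/
lemma exists_measurable_selection {S : Set ℝ} [Nonempty S] {F : ℝ → ℝ → ℂ}
    (hF : ∀ x, Continuous (F x)) (hFm : ∀ T : ℝ → ℝ, Measurable T → Measurable fun x => F x (T x)) :
    ∃ T : ℕ → ℝ → ℝ, (∀ n, Measurable (T n)) ∧ (∀ n x, T n x ∈ S) ∧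
      (∀ x, Monotone fun n => ‖F x (T n x)‖ₑ) ∧
      ∀ x, maximal S F x = ⨆ n, ‖F x (T n x)‖ₑ := by
  classical
  let τ : ℕ → ℝ := fun n => TopologicalSpace.denseSeq S n
  have hτ : ∀ n, τ n ∈ S := fun n => Subtype.coe_prop _
  -- A running maximizer: the current time is kept unless the next time of the dense sequence gives
  -- a strictly larger value.
  let T : ℕ → ℝ → ℝ := fun n => Nat.rec (fun _ => τ 0)
    (fun n p x => if ‖F x (τ (n + 1))‖ₑ ≤ ‖F x (p x)‖ₑ then p x else τ (n + 1)) n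
  have hT : ∀ n x, T (n + 1) x =
      if ‖F x (τ (n + 1))‖ₑ ≤ ‖F x (T n x)‖ₑ then T n x else τ (n + 1) := fun n x => rfl
  have hTm : ∀ n, Measurable (T n) := by
    intro n
    induction n with
    | zero => exact measurable_const
    | succ n ih =>
      exact Measurable.ite (measurableSet_le (hFm _ measurable_const).enorm (hFm _ ih).enorm) ih
        measurable_const
  have hTS : ∀ n x, T n x ∈ S := by
    intro n x
    induction n with
    | zero => exact hτ 0
    | succ n ih => rw [hT]; split_ifs; exacts [ih, hτ _]
  have hmono : ∀ x, Monotone fun n => ‖F x (T n x)‖ₑ := fun x => monotone_nat_of_le_succ fun n => by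
    rw [hT]; split_ifs with h
    · exact le_rfl
    · exact (not_le.1 h).le
  have hge : ∀ n x, ‖F x (τ n)‖ₑ ≤ ‖F x (T n x)‖ₑ := by
    intro n x
    cases n with
    | zero => exact le_rfl
    | succ n =>
      rw [hT]; split_ifs with h
      · exact h
      · exact le_rfl
  refine ⟨T, hTm, hTS, hmono, fun x => le_antisymm ?_ (iSup_le fun n => enorm_le_maximal F x (hTS n x))⟩
  rw [maximal_eq_iSup_denseSeq x (hF x)]
  exact iSup_mono fun n => hge n x

/-- The end of the linearization: monotone convergence along the selected times passes a bound
uniform in T to the supremum. -/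
lemma lintegral_maximal_pow_le {S : Set ℝ} [Nonempty S] {F : ℝ → ℝ → ℂ}
    (hF : ∀ x, Continuous (F x)) (hFm : ∀ T : ℝ → ℝ, Measurable T → Measurable fun x => F x (T x))
    {p : ℕ} {D : ℝ≥0∞}
    (h : ∀ T : ℝ → ℝ, Measurable T → (∀ x, T x ∈ S) → ∫⁻ x, ‖F x (T x)‖ₑ ^ p ≤ D) :
    ∫⁻ x, maximal S F x ^ p ≤ D := by
  obtain ⟨T, hTm, hTS, hmono, hsup⟩ := exists_measurable_selection (S := S) hF hFm
  have h1 : ∀ x, maximal S F x ^ p = ⨆ n, ‖F x (T n x)‖ₑ ^ p := fun x => by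
    rw [hsup x]
    refine tendsto_nhds_unique ?_ (tendsto_atTop_iSup fun m n hmn => ?_)
    · exact ((ENNReal.continuous_pow p).tendsto _).comp (tendsto_atTop_iSup (hmono x))
    · exact pow_le_pow_left' (hmono x hmn) p
  simp_rw [h1]
  rw [lintegral_iSup (fun n => (hFm _ (hTm n)).enorm.pow_const p)
    fun m n hmn x => pow_le_pow_left' (hmono x hmn) p]
  exact iSup_le fun n => h _ (hTm n) (hTS n)

/-! ### Mixed norms and Plancherel -/

lemma mixedNorm_top_le {γ : ℝ} (hγ : 0 < γ) {F : ℝ → ℝ → ℂ} {M : ℝ → ℝ≥0∞} {c : ℝ≥0∞}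
    (hM : ∀ x t, ‖F x t‖ₑ ≤ M x) (h : ∫⁻ x, M x ^ γ ≤ c ^ γ) :
    mixedNorm (ENNReal.ofReal γ) ∞ F ≤ c := by
  have h0 : ENNReal.ofReal γ ≠ 0 := by simpa using hγ
  rw [mixedNorm, eLpNorm_eq_lintegral_rpow_enorm_toReal h0 ENNReal.ofReal_ne_top,
    ENNReal.toReal_ofReal hγ.le, one_div, ENNReal.rpow_inv_le_iff hγ]
  refine le_trans (lintegral_mono fun x => ?_) h
  gcongr
  rw [enorm_eq_self, eLpNorm_exponent_top]
  exact essSup_le_of_ae_le _ (ae_of_all _ fun t => hM x t)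

lemma measurable_hat (u : L2) : Measurable (hat u) := by
  have := (Lp.stronglyMeasurable (𝓕 u : L2)).measurable
  unfold hat
  fun_prop

/-- The squared normalizing factor 1/(2π) is exactly the Jacobian of the dilation by 2π, so
Plancherel carries over without a constant. -/
lemma lintegral_hat_sq (u : L2) : ∫⁻ ξ, ‖hat u ξ‖ₑ ^ 2 = ENNReal.ofReal (‖u‖ ^ 2) := by
  set v : L2 := 𝓕 u with hv
  have hvm := (Lp.stronglyMeasurable v).measurable
  have hpi : 0 < 2 * Real.pi := by positivity
  have h1 : ∀ ξ, ‖hat u ξ‖ₑ ^ 2 =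
      ENNReal.ofReal |(2 * Real.pi)⁻¹| * ‖v ((2 * Real.pi)⁻¹ * ξ)‖ₑ ^ 2 := fun ξ => by
    rw [hat, enorm_mul, mul_pow, ← hv, div_eq_inv_mul ξ, ← ofReal_norm ((_ : ℝ) : ℂ),
      Complex.norm_real, ← ENNReal.ofReal_pow (norm_nonneg _), Real.norm_eq_abs, sq_abs, div_pow,
      Real.sq_sqrt hpi.le, abs_of_pos (by positivity), one_pow, one_div]
  simp_rw [h1]
  rw [lintegral_const_mul _ (by fun_prop)]
  have h2 : ∫⁻ ξ, ‖v ξ‖ₑ ^ 2 =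
      ENNReal.ofReal |(2 * Real.pi)⁻¹| * ∫⁻ ξ, ‖v ((2 * Real.pi)⁻¹ * ξ)‖ₑ ^ 2 := by
    have h := congrArg (fun μ : Measure ℝ => ∫⁻ ξ, (fun ξ => ‖v ξ‖ₑ ^ 2) ξ ∂μ)
      (Real.smul_map_volume_mul_left (inv_pos.2 hpi).ne')
    rw [← h]
    simp only
    rw [lintegral_smul_measure, lintegral_map (by fun_prop) (by fun_prop), smul_eq_mul]
  have h3 : ‖u‖ = ‖v‖ := (Lp.norm_fourier_eq u).symm
  rw [← h2, h3, ENNReal.ofReal_pow (norm_nonneg _), ofReal_norm, Lp.enorm_def,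
    eLpNorm_eq_lintegral_rpow_enorm_toReal (by norm_num) (by norm_num), ← ENNReal.rpow_two,
    ← ENNReal.rpow_mul]
  norm_num

lemma bandLimited_hat {N : ℝ} (hN : 0 < N) {u : L2} (hu : ∀ᵐ ξ : ℝ, 4 * N < |ξ| → hat u ξ = 0) :
    BandLimited N (hat u) := by
  refine ⟨hN, measurable_hat u, ⟨(measurable_hat u).aestronglyMeasurable, ?_⟩, hu⟩
  rw [eLpNorm_lt_top_iff_lintegral_rpow_enorm_lt_top (by norm_num) (by norm_num)]
  simp only [ENNReal.toReal_ofNat, ENNReal.rpow_two]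
  rw [lintegral_hat_sq]
  exact ENNReal.ofReal_lt_top

lemma enorm_propagator_le (u : L2) (x t : ℝ) :
    ‖propagator u x t‖ₑ ≤ ‖waveIntegral (hat u) x t‖ₑ := by
  rw [propagator, enorm_mul]
  refine mul_le_of_le_one_left' ?_
  rw [← ofReal_norm, Complex.norm_real, Real.norm_of_nonneg (by positivity),
    ENNReal.ofReal_le_one, div_le_one (by positivity), Real.one_le_sqrt]
  linarith [Real.pi_gt_three]

/-! ### Moments of the maximal function -/

section Estimates

variable {N : ℝ} {u : L2}

/-- The maximal function of the unnormalized propagator. -/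
noncomputable abbrev maximalWave (S : Set ℝ) (u : L2) : ℝ → ℝ≥0∞ :=
  maximal S (waveIntegral (hat u))

lemma maximalWave_le (hg : BandLimited N (hat u)) (S : Set ℝ) (x : ℝ) :
    maximalWave S u x ≤ ENNReal.ofReal (3 * N ^ (1 / 2 : ℝ) * ‖u‖) := by
  have hN := hg.pos
  refine iSup_le fun t => (hg.enorm_waveIntegral_le x t).trans_eq ?_
  rw [lintegral_hat_sq, ENNReal.ofReal_rpow_of_nonneg (by positivity) (by norm_num),
    ← Real.sqrt_eq_rpow (‖u‖ ^ 2), Real.sqrt_sq (norm_nonneg _), ← ENNReal.ofReal_mul (by positivity)]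

lemma lintegral_maximalWave_pow_four_le (hg : BandLimited N (hat u)) (S : Set ℝ) [Nonempty S] :
    ∫⁻ x, maximalWave S u x ^ 4 ≤
      ENNReal.ofReal ((48 * Real.exp 16) ^ 2 * N * ‖u‖ ^ 4) := by
  have hN := hg.pos
  refine lintegral_maximal_pow_le (continuous_waveIntegral hg.integrable)
    (fun T hT => measurable_waveIntegral hg.measurable hT)
    fun T hT _ => (hg.lintegral_pow_four_le hT).trans_eq ?_
  rw [lintegral_hat_sq, ← ENNReal.ofReal_pow (by positivity), ← ENNReal.ofReal_mul (by positivity)]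
  congr 1; ring

lemma lintegral_maximalWave_sq_le (hg : BandLimited N (hat u)) (hN : 1 ≤ N) :
    ∫⁻ x, maximalWave (Icc (-1) 1) u x ^ 2 ≤ ENNReal.ofReal (192 * Real.exp 16 * N * ‖u‖ ^ 2) := by
  have : Nonempty (Icc (-1 : ℝ) 1) := ⟨⟨0, by norm_num, by norm_num⟩⟩
  refine lintegral_maximal_pow_le (continuous_waveIntegral hg.integrable)
    (fun T hT => measurable_waveIntegral hg.measurable hT)
    fun T hT hTS => (hg.lintegral_sq_le hN hT hTS).trans_eq ?_
  rw [lintegral_hat_sq, ← ENNReal.ofReal_mul (by positivity)]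

/-- Writing M³ = M · M², Cauchy–Schwarz gives (∫ M³)² ≤ ∫ M² ∫ M⁴. Both factors are linear in N, so
the cube moment is too. -/
lemma lintegral_maximalWave_pow_three_le (hg : BandLimited N (hat u)) (hN : 1 ≤ N) :
    ∫⁻ x, maximalWave (Icc (-1) 1) u x ^ 3 ≤
      ENNReal.ofReal (Real.sqrt (192 * Real.exp 16 * (48 * Real.exp 16) ^ 2) * N * ‖u‖ ^ 3) := by
  have : Nonempty (Icc (-1 : ℝ) 1) := ⟨⟨0, by norm_num, by norm_num⟩⟩
  have hm : Measurable (maximalWave (Icc (-1) 1) u) :=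
    measurable_maximal (continuous_waveIntegral hg.integrable)
      fun t => measurable_waveIntegral hg.measurable measurable_const
  have h := sq_lintegral_mul_le (f := maximalWave (Icc (-1) 1) u)
    (g := fun x => maximalWave (Icc (-1) 1) u x ^ 2) (by fun_prop) (by fun_prop)
  simp only [← pow_succ', ← pow_mul] at h
  norm_num at h
  have h' := h.trans (mul_le_mul' (lintegral_maximalWave_sq_le hg hN)
    (lintegral_maximalWave_pow_four_le hg _))
  rw [← ENNReal.pow_le_pow_left_iff two_ne_zero]
  refine h'.trans_eq ?_
  rw [← ENNReal.ofReal_pow (by positivity), ← ENNReal.ofReal_mul (by positivity),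
    mul_pow (_ * N), mul_pow (Real.sqrt _), Real.sq_sqrt (by positivity)]
  congr 1; ring

/-- All but four powers of M are estimated by its sup bound, giving N^{(γ-4)/2}; the fourth moment
supplies one more N, for a total of N^{(γ-2)/2}. -/
lemma lintegral_maximalWave_rpow_le (hg : BandLimited N (hat u)) (S : Set ℝ) [Nonempty S] {γ : ℝ}
    (hγ : 4 ≤ γ) :
    ∫⁻ x, maximalWave S u x ^ γ ≤ ENNReal.ofReal
      (3 ^ (γ - 4) * (48 * Real.exp 16) ^ 2 * N ^ ((γ - 2) / 2) * ‖u‖ ^ γ) := by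
  have hN := hg.pos
  have h1 : ∀ x, maximalWave S u x ^ γ ≤
      ENNReal.ofReal (3 * N ^ (1 / 2 : ℝ) * ‖u‖) ^ (γ - 4) * maximalWave S u x ^ 4 := fun x => by
    calc maximalWave S u x ^ γ = maximalWave S u x ^ (γ - 4) * maximalWave S u x ^ (4 : ℝ) := by
          rw [← ENNReal.rpow_add_of_nonneg _ _ (by linarith) (by norm_num)]; ring_nf
      _ ≤ _ := by
          rw [← ENNReal.rpow_natCast (maximalWave S u x) 4, Nat.cast_ofNat]
          gcongr
          exact maximalWave_le hg S x
  refine (lintegral_mono h1).trans ?_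
  rw [ENNReal.ofReal_rpow_of_nonneg (by positivity) (by linarith),
    lintegral_const_mul' _ _ ENNReal.ofReal_ne_top]
  refine (mul_le_mul_right (lintegral_maximalWave_pow_four_le hg S) _).trans_eq ?_
  rw [← ENNReal.ofReal_mul (by positivity)]
  congr 1
  rw [Real.mul_rpow (by positivity) (norm_nonneg _), Real.mul_rpow (by norm_num) (by positivity),
    ← Real.rpow_mul hN.le]
  have e1 : N ^ ((γ - 2) / 2) = N ^ (1 / 2 * (γ - 4)) * N := by
    rw [← Real.rpow_add_one hN.ne']; ring_nf
  have e2 : ‖u‖ ^ γ = ‖u‖ ^ (γ - 4) * ‖u‖ ^ 4 := by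
    rw [← Real.rpow_natCast, ← Real.rpow_add_of_nonneg (norm_nonneg _) (by linarith) (by norm_num)]
    norm_num
  rw [e1, e2]
  ring

end Estimates

/-! ### Taking roots and assembling the theorem -/

lemma ofReal_const_mul_rpow {K N U γ β : ℝ} (hK : 0 ≤ K) (hN : 0 ≤ N) (hU : 0 ≤ U) (hγ : 0 < γ) :
    ENNReal.ofReal (K ^ (1 / γ) * N ^ (β / γ) * U) ^ γ = ENNReal.ofReal (K * N ^ β * U ^ γ) := by
  rw [ENNReal.ofReal_rpow_of_nonneg (by positivity) hγ.le, Real.mul_rpow (by positivity) hU,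
    Real.mul_rpow (by positivity) (by positivity), ← Real.rpow_mul hK, ← Real.rpow_mul hN,
    one_div_mul_cancel hγ.ne', div_mul_cancel₀ _ hγ.ne', Real.rpow_one]

/-- Reduction of the local-in-time estimates to moments of the maximal function. -/
lemma mixedNorm_indicator_propagator_le {N K : ℝ} {u : L2} (hK : 0 ≤ K) (hN : 0 ≤ N) {p : ℕ}
    (hp : 0 < p)
    (h : ∫⁻ x, maximalWave (Icc (-1) 1) u x ^ p ≤ ENNReal.ofReal (K * N * ‖u‖ ^ p)) :
    mixedNorm (ENNReal.ofReal p) ∞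
        (fun x t => (Icc (-1 : ℝ) 1).indicator (fun s => propagator u x s) t) ≤
      ENNReal.ofReal (K ^ (1 / (p : ℝ)) * N ^ (1 / (p : ℝ)) * ‖u‖) := by
  have hp' : (0 : ℝ) < p := by exact_mod_cast hp
  refine mixedNorm_top_le (M := maximalWave (Icc (-1) 1) u) hp' (fun x t => ?_) ?_
  · by_cases ht : t ∈ Icc (-1 : ℝ) 1
    · rw [indicator_of_mem ht]
      exact (enorm_propagator_le u x t).trans (enorm_le_maximal _ x ht)
    · simp [indicator_of_notMem ht]
  · rw [ofReal_const_mul_rpow hK hN (norm_nonneg _) hp']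
    simpa using h

end Schrodinger

theorem proposition2p4 :
    (∀ γ : ℝ, γ = 2 ∨ γ = 3 →
      ∃ C : ℝ, 0 < C ∧ ∀ (N : ℝ) (u : Schrodinger.L2),
        (((∃ k : ℕ, N = 2 ^ k) ∧
            Schrodinger.FreqSupportedIn u {ξ : ℝ | N ≤ |ξ| ∧ |ξ| ≤ 4 * N}) ∨
          (N = 1 ∧ Schrodinger.FreqSupportedIn u {ξ : ℝ | |ξ| ≤ 1})) →
        Schrodinger.mixedNorm (ENNReal.ofReal γ) ∞
            (fun x t => (Icc (-1 : ℝ) 1).indicator (fun s => Schrodinger.propagator u x s) t)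
          ≤ ENNReal.ofReal (C * N ^ (1 / γ) * ‖u‖)) ∧
    (∀ γ : ℝ, 4 ≤ γ →
      ∃ C : ℝ, 0 < C ∧ ∀ (N : ℝ) (u : Schrodinger.L2),
        (∃ k : ℤ, N = 2 ^ k) →
        Schrodinger.FreqSupportedIn u {ξ : ℝ | N ≤ |ξ| ∧ |ξ| ≤ 4 * N} →
        Schrodinger.mixedNorm (ENNReal.ofReal γ) ∞ (fun x t => Schrodinger.propagator u x t)
          ≤ ENNReal.ofReal (C * N ^ ((γ - 2) / (2 * γ)) * ‖u‖)) := by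
  have hann : ∀ {N : ℝ} {u : Schrodinger.L2}, 0 < N →
      Schrodinger.FreqSupportedIn u {ξ : ℝ | N ≤ |ξ| ∧ |ξ| ≤ 4 * N} →
      Schrodinger.BandLimited N (Schrodinger.hat u) := fun hN hu =>
    Schrodinger.bandLimited_hat hN (by
      filter_upwards [hu] with ξ hξ h4
      exact hξ fun h => absurd h.2 (not_le.2 h4))
  refine ⟨fun γ hγ => ?_, fun γ hγ => ?_⟩
  · have hband : ∀ {N : ℝ} {u : Schrodinger.L2},
        (((∃ k : ℕ, N = 2 ^ k) ∧
            Schrodinger.FreqSupportedIn u {ξ : ℝ | N ≤ |ξ| ∧ |ξ| ≤ 4 * N}) ∨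
          (N = 1 ∧ Schrodinger.FreqSupportedIn u {ξ : ℝ | |ξ| ≤ 1})) →
        1 ≤ N ∧ Schrodinger.BandLimited N (Schrodinger.hat u) := by
      rintro N u (⟨⟨k, rfl⟩, hu⟩ | ⟨rfl, hu⟩)
      · exact ⟨one_le_pow₀ (by norm_num), hann (by positivity) hu⟩
      -- The low-frequency case shares the band of N = 1, since |ξ| ≤ 1 excludes |ξ| > 4.
      · refine ⟨le_rfl, Schrodinger.bandLimited_hat one_pos ?_⟩
        filter_upwards [hu] with ξ hξ h4
        exact hξ fun h => by linarith [show |ξ| ≤ 1 from h]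
    rcases hγ with rfl | rfl
    · refine ⟨(192 * Real.exp 16) ^ (1 / (2 : ℝ)), by positivity, fun N u h => ?_⟩
      obtain ⟨hN, hg⟩ := hband h
      exact_mod_cast Schrodinger.mixedNorm_indicator_propagator_le (by positivity) (by linarith)
        two_pos (Schrodinger.lintegral_maximalWave_sq_le hg hN)
    · refine ⟨Real.sqrt (192 * Real.exp 16 * (48 * Real.exp 16) ^ 2) ^ (1 / (3 : ℝ)),
        by positivity, fun N u h => ?_⟩
      obtain ⟨hN, hg⟩ := hband h
      exact_mod_cast Schrodinger.mixedNorm_indicator_propagator_le (by positivity) (by linarith)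
        three_pos (Schrodinger.lintegral_maximalWave_pow_three_le hg hN)
  · refine ⟨(3 ^ (γ - 4) * (48 * Real.exp 16) ^ 2) ^ (1 / γ), by positivity, ?_⟩
    rintro N u ⟨k, rfl⟩ hu
    have hN : (0 : ℝ) < 2 ^ k := by positivity
    have hg := hann hN hu
    have hγ0 : 0 < γ := by linarith
    refine Schrodinger.mixedNorm_top_le (M := Schrodinger.maximalWave univ u) hγ0 (fun x t =>
      (Schrodinger.enorm_propagator_le u x t).trans
        (Schrodinger.enorm_le_maximal _ x (mem_univ t))) ?_
    -- The exponent is read as ((γ - 2)/2)/γ, the γ-th root of the power of N in the moment bound.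
    rw [← div_div, Schrodinger.ofReal_const_mul_rpow (by positivity) hN.le (norm_nonneg _) hγ0]
    exact Schrodinger.lintegral_maximalWave_rpow_le hg univ hγ
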